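/- Let $(\mathsf X,\mathcal F)$ be a measurable space with a reference measure $\mu$ (for instance a Lebesgue measurable set $\mathsf X\subseteq\mathbb R^d$ with its Lebesgue measurable subsets and Lebesgue measure $\mu(\mathrm dy)=\mathrm dy$), and let $\pi$ be a probability measure on $(\mathsf X,\mathcal F)$. For $i\in\{A,B\}$ let $P_i$ be a propose-accept-reject Markov kernel with invariant distribution $\pi$, proposal density $q_i(x,y)$ and acceptance probability $\alpha_i(x,y)\in[0,1]$, that is, $$P_i(x,\mathrm dy)=q_i(x,y)\,\alpha_i(x,y)\,\mu(\mathrm dy)+\Big[1-\int_{\mathsf X} q_i(x,z)\,\alpha_i(x,z)\,\mu(\mathrm dz)\Big]\,\delta_x(\mathrm dy),$$ where $q_i\ge 0$ and $\int_{\mathsf X} q_i(x,y)\,\mu(\mathrm dy)=1$ for every $x$. A Markov kernel $P$ with invariant distribution $\pi$ is called variance bounding if, for every real-valued $h\in L^2(\pi)$, the asymptotic variance $\lim_{n\to\infty} n\,\mathrm{Var}\big[\frac1n\sum_{j=1}^n h(X_j)\big]$ exists and is finite, where $(X_j)_{j\ge1}$ is the Markov chain with kernel $P$ and $X_1\sim\pi$.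 The conductance of $P$ is $$\kappa=\inf_{A\in\mathcal F:\,0<\pi(A)\le 1/2}\ \frac1{\pi(A)}\int_A P(x,A^c)\,\pi(\mathrm dx)\in[0,\infty]$$ (with $\inf\emptyset=\infty$). For $\varepsilon\ge 0$ and $\delta>0$, let $C(\varepsilon,\delta)$ be the condition: for $\pi$-almost every $x\in\mathsf X$ there is a region $D(x)\in\mathcal F$ such that $$\int_{D(x)^c} q_A(x,y)\,\mu(\mathrm dy)\le\varepsilon\qquad\text{and}\qquad q_B(x,y)\,\alpha_B(x,y)\ \ge\ \delta\, q_A(x,y)\,\alpha_A(x,y)\quad\text{for all } y\in D(x).$$ Suppose that $P_A$ is variance bounding and that for every $\varepsilon>0$ there is a $\delta>0$ such that $C(\varepsilon,\delta)$ holds. Then $P_B$ is variance bounding. Moreover, the conductances $\kappa_A$ and $\kappa_B$ of $P_A$ and $P_B$ satisfy $\kappa_A>0$ and, whenever $0\le\varepsilon<\kappa_A$ and $\delta>0$ are such that $C(\varepsilon,\delta)$ holds, $$\kappa_B\ \ge\ \Big(1-\frac{\varepsilon}{\kappa_A}\Big)\,\delta\,\kappa_A ,$$ where the right-hand side is read as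 $\infty$ if $\kappa_A=\infty$. -/

import Mathlib

open MeasureTheory ProbabilityTheory Filter Topology
open scoped NNReal ENNReal

noncomputable section

namespace PAR

variable {X : Type*} [MeasurableSpace X]

/-- `P` is the propose-accept-reject Markov kernel with proposal density `q` (with respect to the
reference measure `μ`) and acceptance probability `α`:
`P(x, dy) = q(x, y) α(x, y) μ(dy) + [1 - ∫ q(x, z) α(x, z) μ(dz)] δ_x(dy)`. -/
structure IsProposeAcceptReject (μ : Measure X) (q α : X → X → ℝ≥0) (P : Kernel X X) : Prop where
  measurable_proposal : ∀ x, Measurable (q x)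
  lintegral_proposal : ∀ x, ∫⁻ y, (q x y : ℝ≥0∞) ∂μ = 1
  measurable_accept : ∀ x, Measurable (α x)
  accept_le_one : ∀ x y, α x y ≤ 1
  kernel_eq : ∀ x, P x = μ.withDensity (fun y => (q x y : ℝ≥0∞) * (α x y : ℝ≥0∞))
    + (1 - ∫⁻ y, (q x y : ℝ≥0∞) * (α x y : ℝ≥0∞) ∂μ) • Measure.dirac x

/-- The law on `ℕ → X` of the homogeneous Markov chain with transition kernel `P` and initial
distribution `π`. -/
def chainLaw (π : Measure X) (P : Kernel X X) [IsMarkovKernel P] : Measure (ℕ → X) :=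
  Kernel.trajMeasure (X := fun _ : ℕ => X) π
    (fun n => P.comap (fun z : (i : Finset.Iic n) → X => z ⟨n, Finset.mem_Iic.mpr le_rfl⟩)
      (measurable_pi_apply _))

/-- The asymptotic variance `lim_n n Var[(1/n) ∑_{i=1}^n h(X_i)]` of `h`, for the chain started
from `π`, exists and is equal to the real number `v`. -/
def HasAsymptoticVariance (π : Measure X) (P : Kernel X X) [IsMarkovKernel P]
    (h : X → ℝ) (v : ℝ) : Prop :=
  Tendsto
    (fun n : ℕ => (n : ℝ) *
      variance (fun ω : ℕ → X => (1 / (n : ℝ)) * ∑ i ∈ Finset.range n, h (ω i)) (chainLaw π P))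
    atTop (𝓝 v)

/-- `P` is variance bounding: every square-integrable function has a finite asymptotic
variance. -/
def VarianceBounding (π : Measure X) (P : Kernel X X) [IsMarkovKernel P] : Prop :=
  ∀ h : X → ℝ, MemLp h 2 π → ∃ v : ℝ, HasAsymptoticVariance π P h v

/-- The conductance of `P` with respect to `π`: the infimum, over measurable sets `A` with
`0 < π(A) ≤ 1/2`, of `(1 / π(A)) ∫_A P(x, Aᶜ) π(dx)`. -/
def conductance (π : Measure X) (P : Kernel X X) : ℝ≥0∞ :=
  ⨅ (A : Set X) (_ : MeasurableSet A) (_ : 0 < π A) (_ : π A ≤ 1 / 2),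
    (π A)⁻¹ * ∫⁻ x in A, P x Aᶜ ∂π

/-- For `π`-almost every `x` there is a region `D` whose complement has `qA(x, ·)`-mass at most
`ε`, and on which `qB(x, ·) αB(x, ·) ≥ δ qA(x, ·) αA(x, ·)`. -/
def RegionDomination (π μ : Measure X) (qA αA qB αB : X → X → ℝ≥0) (ε δ : ℝ≥0) : Prop :=
  ∀ᵐ x ∂π, ∃ D : Set X, MeasurableSet D ∧
    ∫⁻ y in Dᶜ, (qA x y : ℝ≥0∞) ∂μ ≤ ε ∧
    ∀ y ∈ D, δ * (qA x y * αA x y) ≤ qB x y * αB x y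

end PAR

end

/-! For a stationary chain, reversible or not, variance bounding is equivalent to positive
conductance. Conductance involves only escape probabilities, and these can be compared directly
between the two kernels.

Variance bounding gives conductance. By Banach–Steinhaus the sums `∑ f(X_i)` have norm at most `C √n
‖f‖` for all mean-zero `f`. If `f(X_1) - f(X_0)` were tiny, stationarity would keep `f(X_i)` close
to `f(X_0)`, and the sum would have norm close to `n ‖f‖`, which is too large. Testing on centred
indicators bounds the flow out of a set below (`conductance_pos_of_varianceBounding`).

Conductance gives variance bounding. Cheeger's inequality for the law of `(X_0, X_1)` uses only that
both marginals are `π`. It makes `1 - P` coercive on mean-zero functions, so the Poisson equation `g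
- P g = h` is solvable, and a martingale approximation yields the limit `‖g‖² - ‖P g‖²`
(`varianceBounding_of_conductance_pos`).

Comparison. For `x ∈ A` rejection does not leave `A`, so domination on `D(x)` gives `δ P_A(x, Aᶜ) ≤
P_B(x, Aᶜ) + δ ε`. Averaging over `A` gives `δ (κ_A - ε) ≤ κ_B` (`conductance_comparison`). -/

/-! ### Hilbert-space lemmas: martingale approximation, Poisson equation, increments -/

section Hilbert

open scoped InnerProductSpace

variable {H K : Type*} [NormedAddCommGroup H] [InnerProductSpace ℝ H]
  [NormedAddCommGroup K] [InnerProductSpace ℝ K]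

/-- Martingale approximation: if `h = g - P g`, the normalised square norm of the partial sums of
`U i h` converges. -/
theorem tendsto_norm_sq_sum_of_poisson (U : ℕ → H →ₗᵢ[ℝ] K) (P : H →L[ℝ] H)
    (hU : ∀ i j x y, i ≤ j → ⟪U i x, U (j + 1) y⟫_ℝ = ⟪U i x, U j (P y)⟫_ℝ) (g : H) :
    Tendsto (fun n : ℕ => (n : ℝ)⁻¹ * ‖∑ i ∈ Finset.range n, U i (g - P g)‖ ^ 2) atTop
      (𝓝 (‖g‖ ^ 2 - ‖P g‖ ^ 2)) := by
  -- Martingale differences: `D j` is orthogonal to every `U i x` with `i ≤ j`. The partial sums of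
  -- `U i (g - P g)` are those of `D` up to the boundary term `U 0 g - U n g`, which is bounded and
  -- disappears after division by `√n`.
  set D : ℕ → K := fun i => U (i + 1) g - U i (P g) with hD
  have hUD : ∀ i j x, i ≤ j → ⟪U i x, D j⟫_ℝ = 0 := fun i j x hij => by
    simp only [hD, inner_sub_right, hU i j x g hij, sub_self]
  have hDD : ∀ i j, i < j → ⟪D i, D j⟫_ℝ = 0 := fun i j hij => by
    rw [show D i = U (i + 1) g - U i (P g) from rfl, inner_sub_left, hUD _ _ _ hij,
      hUD _ _ _ hij.le, sub_self]
  have hnD : ∀ i, ‖D i‖ ^ 2 = ‖g‖ ^ 2 - ‖P g‖ ^ 2 := fun i => by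
    have h1 := hU i i (P g) g le_rfl
    rw [real_inner_self_eq_norm_sq, LinearIsometry.norm_map] at h1
    rw [show D i = U (i + 1) g - U i (P g) from rfl, norm_sub_sq_real, real_inner_comm, h1,
      LinearIsometry.norm_map, LinearIsometry.norm_map]
    ring
  set σ := ‖g‖ ^ 2 - ‖P g‖ ^ 2
  have hσ : 0 ≤ σ := by rw [← hnD 0]; positivity
  have hM : ∀ n : ℕ, ‖∑ i ∈ Finset.range n, D i‖ ^ 2 = n * σ := fun n => by
    induction n with
    | zero => simp
    | succ n ih =>
      have : ⟪∑ i ∈ Finset.range n, D i, D n⟫_ℝ = 0 := by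
        rw [sum_inner]
        exact Finset.sum_eq_zero fun i hi => hDD i n (Finset.mem_range.1 hi)
      rw [Finset.sum_range_succ, norm_add_sq_real, this, ih, hnD]
      push_cast; ring
  have hS : ∀ n : ℕ, ∑ i ∈ Finset.range n, U i (g - P g)
      = ∑ i ∈ Finset.range n, D i + (U 0 g - U n g) := fun n => by
    rw [← Finset.sum_range_sub' (fun i => U i g), ← Finset.sum_add_distrib]
    refine Finset.sum_congr rfl fun i _ => ?_
    simp only [hD, map_sub]; abel
  have hb : ∀ n, ‖U 0 g - U n g‖ ≤ 2 * ‖g‖ := fun n => by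
    refine (norm_sub_le _ _).trans ?_
    simp only [LinearIsometry.norm_map]; linarith
  have hlim : Tendsto (fun n : ℕ => (√(n : ℝ))⁻¹ * ‖∑ i ∈ Finset.range n, U i (g - P g)‖) atTop
      (𝓝 (√σ)) := by
    have h0 : Tendsto (fun n : ℕ => (√(n : ℝ))⁻¹) atTop (𝓝 0) :=
      tendsto_inv_atTop_zero.comp (Real.tendsto_sqrt_atTop.comp tendsto_natCast_atTop_atTop)
    have h1 : Tendsto (fun n : ℕ => (√(n : ℝ))⁻¹ * (2 * ‖g‖)) atTop (𝓝 0) := by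
      simpa using h0.mul_const (2 * ‖g‖)
    rw [tendsto_iff_dist_tendsto_zero]
    refine squeeze_zero' (Eventually.of_forall fun _ => dist_nonneg) ?_ h1
    filter_upwards [eventually_gt_atTop 0] with n hn
    have hn' : 0 < √(n : ℝ) := Real.sqrt_pos.2 (by exact_mod_cast hn)
    have : √σ = (√(n : ℝ))⁻¹ * ‖∑ i ∈ Finset.range n, D i‖ := by
      rw [← Real.sqrt_sq (norm_nonneg (∑ i ∈ Finset.range n, D i)), hM,
        Real.sqrt_mul (Nat.cast_nonneg n)]
      field_simp
    rw [this, Real.dist_eq, ← mul_sub, abs_mul, abs_of_pos (inv_pos.2 hn')]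
    refine mul_le_mul_of_nonneg_left ((abs_norm_sub_norm_le _ _).trans ?_) (inv_pos.2 hn').le
    rw [hS, add_sub_cancel_left]
    exact hb n
  have := hlim.pow 2
  rw [Real.sq_sqrt hσ] at this
  refine this.congr fun n => ?_
  rw [mul_pow, inv_pow, Real.sq_sqrt (Nat.cast_nonneg n)]

/-- The Poisson equation is solvable on the orthogonal complement of an invariant vector as soon
as `1 - P` is coercive there. -/
theorem exists_poisson_solution [CompleteSpace H] (P : H →L[ℝ] H) {e : H} (he : ‖e‖ = 1)
    (hPe : P e = e) (heP : ∀ f, ⟪e, P f⟫_ℝ = ⟪e, f⟫_ℝ) {c : ℝ} (hc : 0 < c)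
    (hgap : ∀ f, ⟪e, f⟫_ℝ = 0 → c * ‖f‖ ^ 2 ≤ ⟪f - P f, f⟫_ℝ) {h : H} (hh : ⟪e, h⟫_ℝ = 0) :
    ∃ g, g - P g = h := by
  have hee : ⟪e, e⟫_ℝ = 1 := by rw [real_inner_self_eq_norm_sq, he, one_pow]
  -- The rank-one term supplies coercivity along `e`, where `1 - P` vanishes, so `A` is coercive on
  -- all of `H` and hence invertible. Since `h ⊥ e` forces `g ⊥ e`, the term drops out at the end.
  let A : H →L[ℝ] H := ContinuousLinearMap.id ℝ H - P + (innerSL ℝ e).smulRight e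
  have hA : ∀ f, A f = f - P f + ⟪e, f⟫_ℝ • e := fun f => by simp [A]
  have hcoer : ∀ f, min c 1 * ‖f‖ ^ 2 ≤ ⟪A f, f⟫_ℝ := fun f => by
    set a := ⟪e, f⟫_ℝ with ha
    set u := f - a • e with hu
    have hf : f = u + a • e := by simp [hu]
    have heu : ⟪e, u⟫_ℝ = 0 := by
      rw [hu, inner_sub_right, inner_smul_right, hee, ← ha, mul_one, sub_self]
    have hue : ⟪u, e⟫_ℝ = 0 := by rw [real_inner_comm]; exact heu
    have h1 : f - P f = u - P u := by
      rw [hf, map_add, map_smul, hPe]; abel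
    have h2 : ⟪A f, f⟫_ℝ = ⟪u - P u, u⟫_ℝ + a ^ 2 := by
      have h3 : ⟪u - P u, e⟫_ℝ = 0 := by
        rw [real_inner_comm, inner_sub_right, heP, sub_self]
      rw [hA, h1, inner_add_left, inner_smul_left, ← ha]
      nth_rw 1 [hf]
      rw [inner_add_right, inner_smul_right, h3]
      simp; ring
    have h4 : ‖f‖ ^ 2 = ‖u‖ ^ 2 + a ^ 2 := by
      rw [hf, norm_add_sq_real, inner_smul_right, hue, norm_smul, he]
      simp
    rw [h2, h4, mul_add]
    refine add_le_add ((mul_le_mul_of_nonneg_right (min_le_left _ _) (by positivity)).trans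
      (hgap u heu)) (mul_le_of_le_one_left (by positivity) (min_le_right _ _))
  have hm : 0 < min c 1 := lt_min hc one_pos
  have hunit : IsUnit A := by
    refine ContinuousLinearMap.isUnit_of_forall_le_norm_inner_map A (c := ⟨min c 1, hm.le⟩) hm
      fun f => ?_
    refine le_trans ?_ ((hcoer f).trans (le_abs_self _))
    rw [mul_comm]; rfl
  obtain ⟨g, hg⟩ := ((ContinuousLinearMap.isUnit_iff_bijective).1 hunit).2 h
  refine ⟨g, ?_⟩
  have h5 : ⟪e, g⟫_ℝ = 0 := by
    have := congrArg (fun v => ⟪e, v⟫_ℝ) hg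
    simpa only [hA, inner_add_right, inner_sub_right, heP, inner_smul_right, hee, hh, sub_self,
      zero_add, mul_one] using this
  rw [← hg, hA, h5, zero_smul, add_zero]

/-- If the normalised partial sums of `U i f` stay bounded by `C ‖f‖` uniformly in `f ⊥ e`, the
first increment `U 1 f - U 0 f` is bounded below. -/
theorem exists_norm_le_norm_sub_of_norm_sum_le (U : ℕ → H →ₗᵢ[ℝ] K) (e : H)
    (hU : ∀ i f, ‖U (i + 1) f - U i f‖ = ‖U 1 f - U 0 f‖) {C : ℝ}
    (hC : ∀ (n : ℕ) f, ⟪e, f⟫_ℝ = 0 → ‖∑ i ∈ Finset.range n, U i f‖ ≤ C * √n * ‖f‖) :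
    ∃ M : ℝ, 0 < M ∧ ∀ f, ⟪e, f⟫_ℝ = 0 → ‖f‖ ≤ M * ‖U 1 f - U 0 f‖ := by
  -- This size of `n` ensures `C √n + 1 ≤ n`, so that `n ‖f‖ ≤ C √n ‖f‖ + n² ε` leaves `‖f‖ ≤ n² ε`.
  obtain ⟨n, hn⟩ := exists_nat_gt ((|C| + 1) ^ 2)
  have hn0 : (0 : ℝ) < n := lt_of_le_of_lt (by positivity) hn
  have hsq : |C| + 1 < √n := Real.lt_sqrt_of_sq_lt hn
  refine ⟨(n : ℝ) * n, by positivity, fun f hf => ?_⟩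
  set ε := ‖U 1 f - U 0 f‖
  have h1 : ∀ i : ℕ, ‖U i f - U 0 f‖ ≤ i * ε := fun i => by
    induction i with
    | zero => simp
    | succ i ih =>
      calc ‖U (i + 1) f - U 0 f‖ ≤ ‖U (i + 1) f - U i f‖ + ‖U i f - U 0 f‖ :=
            norm_sub_le_norm_sub_add_norm_sub _ _ _
        _ ≤ ε + i * ε := add_le_add (hU i f).le ih
        _ = ((i + 1 : ℕ) : ℝ) * ε := by push_cast; ring
  have h2 : ‖∑ i ∈ Finset.range n, U i f - (n : ℝ) • U 0 f‖ ≤ n * (n * ε) := by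
    have : ∑ i ∈ Finset.range n, U i f - (n : ℝ) • U 0 f
        = ∑ i ∈ Finset.range n, (U i f - U 0 f) := by
      simp [Finset.sum_sub_distrib, Nat.cast_smul_eq_nsmul]
    rw [this]
    calc _ ≤ ∑ i ∈ Finset.range n, (n : ℝ) * ε := by
          refine norm_sum_le_of_le _ fun i hi => (h1 i).trans ?_
          exact mul_le_mul_of_nonneg_right
            (by exact_mod_cast (Finset.mem_range.1 hi).le) (norm_nonneg _)
      _ = _ := by simp
  have h3 : (n : ℝ) * ‖f‖ ≤ C * √n * ‖f‖ + n * (n * ε) := by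
    calc (n : ℝ) * ‖f‖ = ‖(n : ℝ) • U 0 f‖ := by simp [norm_smul]
      _ ≤ ‖∑ i ∈ Finset.range n, U i f‖ + ‖∑ i ∈ Finset.range n, U i f - (n : ℝ) • U 0 f‖ := by
          have := norm_sub_norm_le ((n : ℝ) • U 0 f) (∑ i ∈ Finset.range n, U i f)
          rw [norm_sub_rev] at this
          linarith
      _ ≤ _ := add_le_add (hC n f hf) h2
  have hs1 : 1 ≤ √(n : ℝ) := by linarith [abs_nonneg C]
  have hsn : √(n : ℝ) * √n = n := Real.mul_self_sqrt hn0.le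
  have h4 : C * √n + 1 ≤ n := by nlinarith [le_abs_self C]
  nlinarith [norm_nonneg f]

end Hilbert

/-! ### The stationary chain and its Markov operator on `L²(π)` -/

namespace PAR

open scoped InnerProductSpace

section Chain

variable {X : Type*} [MeasurableSpace X] {π : Measure X}
  {P : Kernel X X} [IsMarkovKernel P]

theorem map_chainLaw_zero : (chainLaw π P).map (fun ω => ω 0) = π := by
  have h : (fun ω : ℕ → X => ω 0) = (fun z : (i : Finset.Iic 0) → X =>
      z ⟨0, Finset.mem_Iic.mpr le_rfl⟩) ∘ Preorder.frestrictLe (π := fun _ : ℕ => X) 0 := rfl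
  rw [h, ← Measure.map_map (by fun_prop) (by fun_prop), chainLaw, Kernel.trajMeasure,
    Measure.map_comp _ _ (by fun_prop), Kernel.traj_map_frestrictLe, Kernel.partialTraj_self,
    Measure.id_comp, Measure.map_map (by fun_prop) (by fun_prop)]
  exact Measure.map_id

variable [IsProbabilityMeasure π]

instance : IsProbabilityMeasure (chainLaw π P) := by
  unfold chainLaw; infer_instance

theorem map_history_compProd (n : ℕ) :
    (chainLaw π P).map (Preorder.frestrictLe (π := fun _ : ℕ => X) n) ⊗ₘ
        (P.comap (fun z : (i : Finset.Iic n) → X => z ⟨n, Finset.mem_Iic.mpr le_rfl⟩)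
          (measurable_pi_apply _))
      = (chainLaw π P).map (fun ω => (Preorder.frestrictLe (π := fun _ : ℕ => X) n ω, ω (n + 1))) :=
  Kernel.map_frestrictLe_trajMeasure_compProd_eq_map_trajMeasure

theorem map_chainLaw_succ (n : ℕ) :
    (chainLaw π P).map (fun ω => ω (n + 1)) = P ∘ₘ ((chainLaw π P).map (fun ω => ω n)) := by
  have h := congrArg Measure.snd (map_history_compProd (π := π) (P := P) n)
  rw [Measure.snd_compProd, Measure.snd, Measure.map_map (by fun_prop) (by fun_prop)] at h
  rw [show (fun ω : ℕ → X => ω (n + 1)) = Prod.snd ∘ fun ω : ℕ → X =>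
    (Preorder.frestrictLe (π := fun _ : ℕ => X) n ω, ω (n + 1)) from rfl, ← h]
  rw [← Kernel.comp_deterministic_eq_comap, ← Measure.comp_assoc, Measure.deterministic_comp_eq_map,
    Measure.map_map (by fun_prop) (by fun_prop)]
  rfl

theorem measurePreserving_eval_chainLaw (hπ : Kernel.Invariant P π) (n : ℕ) :
    MeasurePreserving (fun ω : ℕ → X => ω n) (chainLaw π P) π := by
  refine ⟨measurable_pi_apply n, ?_⟩
  induction n with
  | zero => exact map_chainLaw_zero
  | succ n ih => rw [map_chainLaw_succ, ih]; exact hπ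

theorem integral_eval_chainLaw (hπ : Kernel.Invariant P π) (n : ℕ) {f : X → ℝ}
    (hf : AEStronglyMeasurable f π) :
    ∫ ω, f (ω n) ∂(chainLaw π P) = ∫ x, f x ∂π := by
  have h := measurePreserving_eval_chainLaw hπ n
  conv_rhs => rw [← h.map_eq]
  rw [integral_map h.aemeasurable]
  rwa [h.map_eq]

/-- The Markov property, tested against a product of square-integrable functions. -/
theorem integral_mul_chainLaw (hπ : Kernel.Invariant P π) {f g : X → ℝ}
    (hf : StronglyMeasurable f) (hg : StronglyMeasurable g) (hf2 : MemLp f 2 π) (hg2 : MemLp g 2 π)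
    {i j : ℕ} (hij : i ≤ j) :
    ∫ ω, f (ω i) * g (ω (j + 1)) ∂(chainLaw π P)
      = ∫ ω, f (ω i) * (∫ y, g y ∂(P (ω j))) ∂(chainLaw π P) := by
  have hint : Integrable (fun ω : ℕ → X => f (ω i) * g (ω (j + 1))) (chainLaw π P) :=
    (hf2.comp_measurePreserving (measurePreserving_eval_chainLaw hπ i)).integrable_mul
      (hg2.comp_measurePreserving (measurePreserving_eval_chainLaw hπ (j + 1)))
  set G : ((k : Finset.Iic j) → X) × X → ℝ := fun p => f (p.1 ⟨i, Finset.mem_Iic.2 hij⟩) * g p.2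
    with hG
  have hGm : StronglyMeasurable G := by
    have h1 : Measurable f := hf.measurable
    have h2 : Measurable g := hg.measurable
    exact Measurable.stronglyMeasurable (by fun_prop)
  have hmeas : Measurable (fun ω : ℕ → X =>
      (Preorder.frestrictLe (π := fun _ : ℕ => X) j ω, ω (j + 1))) := by fun_prop
  have hm2 : Measurable (Preorder.frestrictLe (π := fun _ : ℕ => X) j) := by fun_prop
  have hGint : Integrable G ((chainLaw π P).map (Preorder.frestrictLe (π := fun _ : ℕ => X) j) ⊗ₘ
        (P.comap (fun z : (i : Finset.Iic j) → X => z ⟨j, Finset.mem_Iic.mpr le_rfl⟩)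
          (measurable_pi_apply _))) := by
    rw [map_history_compProd, integrable_map_measure hGm.aestronglyMeasurable hmeas.aemeasurable]
    exact hint
  have h := Measure.integral_compProd hGint
  rw [map_history_compProd, integral_map hmeas.aemeasurable hGm.aestronglyMeasurable,
    integral_map hm2.aemeasurable] at h
  · simpa [hG, integral_const_mul, Kernel.comap_apply] using h
  · exact (hGm.integral_kernel_prod_right' (κ := P.comap (fun z : (i : Finset.Iic j) → X =>
      z ⟨j, Finset.mem_Iic.mpr le_rfl⟩) (measurable_pi_apply _))).aestronglyMeasurable

/-- The isometric embedding `f ↦ f (X_n)` of `L²(π)` into `L²` of the chain. -/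
noncomputable def evalIsometry (hπ : Kernel.Invariant P π) (n : ℕ) :
    Lp ℝ 2 π →ₗᵢ[ℝ] Lp ℝ 2 (chainLaw π P) :=
  Lp.compMeasurePreservingₗᵢ ℝ _ (measurePreserving_eval_chainLaw hπ n)

theorem coeFn_evalIsometry (hπ : Kernel.Invariant P π) (n : ℕ) (f : Lp ℝ 2 π) :
    evalIsometry hπ n f =ᵐ[chainLaw π P] fun ω => f (ω n) :=
  Lp.coeFn_compMeasurePreserving f (measurePreserving_eval_chainLaw hπ n)

/-- The Markov operator on `L²(π)`. -/
noncomputable def markovOperator (hπ : Kernel.Invariant P π) : Lp ℝ 2 π →L[ℝ] Lp ℝ 2 π :=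
  (ContinuousLinearMap.adjoint (evalIsometry hπ 0).toContinuousLinearMap).comp
    (evalIsometry hπ 1).toContinuousLinearMap

theorem inner_markovOperator (hπ : Kernel.Invariant P π) (f g : Lp ℝ 2 π) :
    ⟪f, markovOperator hπ g⟫_ℝ = ⟪evalIsometry hπ 0 f, evalIsometry hπ 1 g⟫_ℝ := by
  simp [markovOperator, ContinuousLinearMap.adjoint_inner_right]

theorem inner_evalIsometry_succ_eq_integral (hπ : Kernel.Invariant P π) (f g : Lp ℝ 2 π) {i j : ℕ}
    (hij : i ≤ j) :
    ⟪evalIsometry hπ i f, evalIsometry hπ (j + 1) g⟫_ℝ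
      = ∫ ω, f (ω i) * (∫ y, g y ∂(P (ω j))) ∂(chainLaw π P) := by
  rw [← integral_mul_chainLaw hπ (Lp.stronglyMeasurable f) (Lp.stronglyMeasurable g) (Lp.memLp f)
    (Lp.memLp g) hij, L2.inner_def]
  refine integral_congr_ae ?_
  filter_upwards [coeFn_evalIsometry hπ i f, coeFn_evalIsometry hπ (j + 1) g] with ω h1 h2
  rw [h1, h2]; simp [mul_comm]

/-- Identifies the operator, built as an adjoint, with integration against the kernel: pairing with
indicators reduces the claim to the Markov property between times 0 and 1. -/
theorem coeFn_markovOperator (hπ : Kernel.Invariant P π) (g : Lp ℝ 2 π) :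
    markovOperator hπ g =ᵐ[π] fun x => ∫ y, g y ∂(P x) := by
  have hgi : Integrable g π := (Lp.memLp g).integrable one_le_two
  have hgK : Integrable (fun x => ∫ y, g y ∂(P x)) π := by
    have : Integrable g (P ∘ₘ π) := by rwa [show P ∘ₘ π = π from hπ]
    refine (Measure.integrable_integral_norm_of_integrable_comp this).mono'
      (Lp.stronglyMeasurable g).integral_kernel.aestronglyMeasurable
      (Eventually.of_forall fun x => norm_integral_le_integral_norm _)
  refine Integrable.ae_eq_of_forall_setIntegral_eq _ _ ((Lp.memLp _).integrable one_le_two) hgK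
    fun s hs _ => ?_
  have hm : StronglyMeasurable (fun x => ∫ y, g y ∂(P x)) :=
    (Lp.stronglyMeasurable g).integral_kernel
  rw [← L2.inner_indicatorConstLp_one (𝕜 := ℝ) hs (measure_ne_top π s), inner_markovOperator,
    inner_evalIsometry_succ_eq_integral hπ _ _ le_rfl, ← integral_indicator hs,
    ← integral_eval_chainLaw hπ 0 (hm.indicator hs).aestronglyMeasurable]
  have h1 : ∀ᵐ x ∂π, indicatorConstLp 2 hs (measure_ne_top π s) (1 : ℝ) x
      = s.indicator (fun _ => (1 : ℝ)) x := indicatorConstLp_coeFn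
  refine integral_congr_ae ?_
  filter_upwards [(measurePreserving_eval_chainLaw hπ 0).quasiMeasurePreserving.ae h1] with ω h2
  rw [h2]
  by_cases h3 : ω 0 ∈ s <;> simp [h3]

/-- The Markov property in the form the martingale approximation needs: against functions of a
single earlier coordinate, `g(X_{j+1})` may be replaced by `(P g)(X_j)`. -/
theorem inner_evalIsometry_succ (hπ : Kernel.Invariant P π) (i j : ℕ) (f g : Lp ℝ 2 π)
    (hij : i ≤ j) :
    ⟪evalIsometry hπ i f, evalIsometry hπ (j + 1) g⟫_ℝ
      = ⟪evalIsometry hπ i f, evalIsometry hπ j (markovOperator hπ g)⟫_ℝ := by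
  rw [inner_evalIsometry_succ_eq_integral hπ f g hij, L2.inner_def]
  refine integral_congr_ae ?_
  filter_upwards [coeFn_evalIsometry hπ i f, coeFn_evalIsometry hπ j (markovOperator hπ g),
    (measurePreserving_eval_chainLaw hπ j).quasiMeasurePreserving.ae (coeFn_markovOperator hπ g)]
    with ω h1 h2 h3
  rw [h1, h2, h3]; simp [mul_comm]

/-- Stationarity makes the increment independent of `i` and equal to twice the Dirichlet form, the
link between coercivity of `1 - P` and the law of `(X_0, X_1)`. -/
theorem norm_evalIsometry_succ_sub (hπ : Kernel.Invariant P π) (i : ℕ) (f : Lp ℝ 2 π) :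
    ‖evalIsometry hπ (i + 1) f - evalIsometry hπ i f‖ ^ 2
      = 2 * ⟪f - markovOperator hπ f, f⟫_ℝ := by
  have h := inner_evalIsometry_succ hπ i i f f le_rfl
  rw [LinearIsometry.inner_map_map] at h
  rw [norm_sub_sq_real, real_inner_comm, h, LinearIsometry.norm_map, LinearIsometry.norm_map,
    inner_sub_left, real_inner_self_eq_norm_sq, real_inner_comm]
  ring

variable (π) in
/-- The constant function `1` in `L²(π)`. -/
noncomputable def oneLp : Lp ℝ 2 π := (memLp_const (1 : ℝ)).toLp _

theorem norm_oneLp : ‖oneLp π‖ = 1 := by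
  simp [oneLp, Lp.norm_const]

theorem inner_oneLp (f : Lp ℝ 2 π) : ⟪oneLp π, f⟫_ℝ = ∫ x, f x ∂π := by
  rw [L2.inner_def]
  refine integral_congr_ae ?_
  filter_upwards [(memLp_const (μ := π) (p := 2) (1 : ℝ)).coeFn_toLp] with x hx
  rw [oneLp, hx]; simp

theorem evalIsometry_oneLp (hπ : Kernel.Invariant P π) (n : ℕ) :
    evalIsometry hπ n (oneLp π) = oneLp (chainLaw π P) := rfl

/-- All the embeddings send `1` to the same constant, so they can be exchanged for one another in an
inner product with it. -/
theorem inner_oneLp_markovOperator (hπ : Kernel.Invariant P π) (f : Lp ℝ 2 π) :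
    ⟪oneLp π, markovOperator hπ f⟫_ℝ = ⟪oneLp π, f⟫_ℝ := by
  rw [inner_markovOperator, evalIsometry_oneLp, ← evalIsometry_oneLp hπ 1,
    LinearIsometry.inner_map_map]

theorem markovOperator_oneLp (hπ : Kernel.Invariant P π) :
    markovOperator hπ (oneLp π) = oneLp π := by
  refine ext_inner_left ℝ fun f => ?_
  rw [inner_markovOperator, evalIsometry_oneLp, ← evalIsometry_oneLp hπ 0,
    LinearIsometry.inner_map_map]

/-- The normalised variance of the ergodic averages, as a Hilbert space norm. -/
theorem mul_variance_chainLaw (hπ : Kernel.Invariant P π) {h : X → ℝ} (hh : MemLp h 2 π) (n : ℕ) :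
    (n : ℝ) * variance (fun ω : ℕ → X => (1 / (n : ℝ)) * ∑ i ∈ Finset.range n, h (ω i))
        (chainLaw π P)
      = (n : ℝ)⁻¹ * ‖∑ i ∈ Finset.range n,
          evalIsometry hπ i (hh.toLp h - ⟪oneLp π, hh.toLp h⟫_ℝ • oneLp π)‖ ^ 2 := by
  set a := ⟪oneLp π, hh.toLp h⟫_ℝ with ha
  have ha' : a = ∫ x, h x ∂π := by
    rw [ha, inner_oneLp]; exact integral_congr_ae hh.coeFn_toLp
  have hmp := measurePreserving_eval_chainLaw (P := P) hπ
  have hL : ∀ i, MemLp (fun ω : ℕ → X => h (ω i)) 2 (chainLaw π P) :=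
    fun i => hh.comp_measurePreserving (hmp i)
  have hS : MemLp (fun ω : ℕ → X => ∑ i ∈ Finset.range n, h (ω i)) 2 (chainLaw π P) :=
    memLp_finsetSum _ fun i _ => hL i
  have hE : ∫ ω, ∑ i ∈ Finset.range n, h (ω i) ∂(chainLaw π P) = n * a := by
    rw [integral_finsetSum _ fun i _ => (hL i).integrable one_le_two]
    have : ∀ i, ∫ ω, h (ω i) ∂(chainLaw π P) = a := fun i => by
      rw [ha', integral_eval_chainLaw hπ i hh.aestronglyMeasurable]
    simp [this]
  rw [variance_const_mul, variance_eq_integral hS.aemeasurable, hE,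
    ← real_inner_self_eq_norm_sq, L2.inner_def]
  have hcongr : ∫ ω, (∑ i ∈ Finset.range n, h (ω i) - n * a) ^ 2 ∂(chainLaw π P)
      = ∫ ω, ⟪(∑ i ∈ Finset.range n, evalIsometry hπ i (hh.toLp h - a • oneLp π) :
          Lp ℝ 2 (chainLaw π P)) ω,
        (∑ i ∈ Finset.range n, evalIsometry hπ i (hh.toLp h - a • oneLp π) :
          Lp ℝ 2 (chainLaw π P)) ω⟫_ℝ ∂(chainLaw π P) := by
    have hterm : ∀ i, evalIsometry hπ i (hh.toLp h - a • oneLp π) =ᵐ[chainLaw π P]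
        fun ω => h (ω i) - a := fun i => by
      have h1 : (hh.toLp h - a • oneLp π : Lp ℝ 2 π) =ᵐ[π] fun x => h x - a := by
        filter_upwards [Lp.coeFn_sub (hh.toLp h) (a • oneLp π), Lp.coeFn_smul a (oneLp π),
          hh.coeFn_toLp, (memLp_const (μ := π) (p := 2) (1 : ℝ)).coeFn_toLp] with x e1 e2 e3 e4
        rw [e1, Pi.sub_apply, e2, Pi.smul_apply, e3, oneLp, e4]; simp
      filter_upwards [coeFn_evalIsometry hπ i (hh.toLp h - a • oneLp π),
        (hmp i).quasiMeasurePreserving.ae h1] with ω e1 e2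
      rw [e1, e2]
    refine integral_congr_ae ?_
    filter_upwards [Lp.coeFn_fun_finsetSum (Finset.range n)
      (fun i => evalIsometry hπ i (hh.toLp h - a • oneLp π)), ae_all_iff.2 hterm] with ω e1 e2
    rw [e1]
    simp only [e2]
    simp [Finset.sum_sub_distrib, pow_two]
  rw [hcongr]
  rcases Nat.eq_zero_or_pos n with rfl | hn
  · simp
  · have : (n : ℝ) ≠ 0 := by positivity
    field_simp

end Chain

end PAR

/-! ### Cheeger's inequality without reversibility -/

/-- Existence of a median. -/
theorem exists_median {X : Type*} [MeasurableSpace X] (π : Measure X) [IsProbabilityMeasure π]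
    {f : X → ℝ} (hf : Measurable f) :
    ∃ m : ℝ, π {x | m < f x} ≤ 1 / 2 ∧ π {x | f x < m} ≤ 1 / 2 := by
  set S : Set ℝ := {t | π {x | t < f x} ≤ 1 / 2} with hS
  have hm1 : ∀ t : ℝ, MeasurableSet {x | t < f x} := fun t => measurableSet_lt measurable_const hf
  have hne : S.Nonempty := by
    have h : Tendsto (fun n : ℕ => π {x | (n : ℝ) < f x}) atTop
        (𝓝 (π (⋂ n : ℕ, {x | (n : ℝ) < f x}))) := by
      refine tendsto_measure_iInter_atTop (fun n => (hm1 n).nullMeasurableSet) ?_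
        ⟨0, measure_ne_top _ _⟩
      intro a b hab x hx
      exact lt_of_le_of_lt (Nat.cast_le.2 hab) (show (b : ℝ) < f x from hx)
    have h0 : (⋂ n : ℕ, {x | (n : ℝ) < f x}) = ∅ := by
      refine Set.eq_empty_of_forall_notMem fun x hx => ?_
      obtain ⟨n, hn⟩ := exists_nat_gt (f x)
      exact absurd (Set.mem_iInter.1 hx n) (not_lt.2 hn.le)
    rw [h0, measure_empty] at h
    obtain ⟨n, hn⟩ := (h.eventually_le_const (u := 1 / 2) (by simp)).exists
    exact ⟨n, hn⟩
  have hbdd : BddBelow S := by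
    have h : Tendsto (fun n : ℕ => π {x | -(n : ℝ) < f x}) atTop
        (𝓝 (π (⋃ n : ℕ, {x | -(n : ℝ) < f x}))) := by
      refine tendsto_measure_iUnion_atTop ?_
      intro a b hab x hx
      exact lt_of_le_of_lt (neg_le_neg (Nat.cast_le.2 hab)) (show -(a : ℝ) < f x from hx)
    have h0 : (⋃ n : ℕ, {x | -(n : ℝ) < f x}) = Set.univ := by
      refine Set.eq_univ_of_forall fun x => ?_
      obtain ⟨n, hn⟩ := exists_nat_gt (-f x)
      exact Set.mem_iUnion.2 ⟨n, by simpa using neg_lt.1 hn⟩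
    rw [h0, measure_univ] at h
    obtain ⟨n, hn⟩ := (h.eventually_const_lt (u := 1 / 2)
      (by simp)).exists
    refine ⟨-(n : ℝ), fun t ht => ?_⟩
    by_contra hlt
    refine absurd ht (not_le.2 (hn.trans_le (measure_mono fun x hx => ?_)))
    exact lt_trans (not_le.1 hlt) hx
  -- Both bounds are limits along increasing unions: levels `sInf S + 1/(n+1)` lie above a member of
  -- `S`, while levels `sInf S - 1/(n+1)` are not in `S`.
  refine ⟨sInf S, ?_, ?_⟩
  · have hU : {x | sInf S < f x} = ⋃ n : ℕ, {x | sInf S + 1 / ((n : ℝ) + 1) < f x} := by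
      ext x
      simp only [Set.mem_ofPred_eq, Set.mem_iUnion]
      refine ⟨fun hx => ?_, fun ⟨n, hn⟩ => lt_trans (by simp; positivity) hn⟩
      obtain ⟨n, hn⟩ := exists_nat_one_div_lt (sub_pos.2 hx)
      exact ⟨n, by linarith⟩
    have h : Tendsto (fun n : ℕ => π {x | sInf S + 1 / ((n : ℝ) + 1) < f x}) atTop
        (𝓝 (π {x | sInf S < f x})) := by
      rw [hU]
      refine tendsto_measure_iUnion_atTop ?_
      intro a b hab x hx
      refine lt_of_le_of_lt ?_ (show sInf S + 1 / ((a : ℝ) + 1) < f x from hx)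
      gcongr
    refine le_of_tendsto' h fun n => ?_
    obtain ⟨t, ht, htlt⟩ := exists_lt_of_csInf_lt hne
      (show sInf S < sInf S + 1 / ((n : ℝ) + 1) by simp; positivity)
    exact (measure_mono fun x hx => lt_trans htlt hx).trans ht
  · have hU : {x | f x < sInf S} = ⋃ n : ℕ, {x | f x ≤ sInf S - 1 / ((n : ℝ) + 1)} := by
      ext x
      simp only [Set.mem_ofPred_eq, Set.mem_iUnion]
      refine ⟨fun hx => ?_, fun ⟨n, hn⟩ => lt_of_le_of_lt hn (by simp; positivity)⟩
      obtain ⟨n, hn⟩ := exists_nat_one_div_lt (sub_pos.2 hx)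
      exact ⟨n, by linarith⟩
    have h : Tendsto (fun n : ℕ => π {x | f x ≤ sInf S - 1 / ((n : ℝ) + 1)}) atTop
        (𝓝 (π {x | f x < sInf S})) := by
      rw [hU]
      refine tendsto_measure_iUnion_atTop ?_
      intro a b hab x hx
      refine le_trans (show f x ≤ sInf S - 1 / ((a : ℝ) + 1) from hx) ?_
      gcongr
    refine le_of_tendsto' h fun n => ?_
    have hn : sInf S - 1 / ((n : ℝ) + 1) ∉ S := fun hmem => by
      have := csInf_le hbdd hmem
      have h2 : 0 < 1 / ((n : ℝ) + 1) := by positivity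
      linarith
    have hlt : 1 / 2 < π {x | sInf S - 1 / ((n : ℝ) + 1) < f x} := not_le.1 hn
    have hc : {x | f x ≤ sInf S - 1 / ((n : ℝ) + 1)}
        = {x | sInf S - 1 / ((n : ℝ) + 1) < f x}ᶜ := by ext x; simp
    rw [hc, prob_compl_eq_one_sub (hm1 _), tsub_le_iff_right]
    calc (1 : ℝ≥0∞) = 1 / 2 + 1 / 2 := (ENNReal.add_halves 1).symm
      _ ≤ _ := add_le_add_right hlt.le _

section Cheeger

variable {X : Type*} [MeasurableSpace X] {π : Measure X} {Q : Measure (X × X)}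
  [IsProbabilityMeasure Q]

/-- The coarea step in Cheeger's inequality. -/
theorem mul_lintegral_le_lintegral_sub {κ : ℝ≥0∞} {v : X → ℝ} (hv : Measurable v)
    (hv0 : ∀ x, 0 ≤ v x)
    (hκ : ∀ t, 0 < t → κ * π {x | t < v x} ≤ Q ({x | t < v x} ×ˢ {x | t < v x}ᶜ)) :
    κ * ∫⁻ x, ENNReal.ofReal (v x) ∂π ≤ ∫⁻ p, ENNReal.ofReal (v p.1 - v p.2) ∂Q := by
  set S : Set ((X × X) × ℝ) := {p | v p.1.2 ≤ p.2 ∧ p.2 < v p.1.1} with hS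
  -- The slice of `S` at `(x, y)` is `[v y, v x)`, of length `(v x - v y)⁺`; its slice at `t`
  -- contains `{v > t} × {v ≤ t}`. Tonelli compares the two.
  have hSm : MeasurableSet S :=
    (measurableSet_le (f := fun p : (X × X) × ℝ => v p.1.2) (g := fun p => p.2)
      (by fun_prop) (by fun_prop)).inter
    (measurableSet_lt (f := fun p : (X × X) × ℝ => p.2) (g := fun p => v p.1.1)
      (by fun_prop) (by fun_prop))
  have h1 : ∫⁻ p, ENNReal.ofReal (v p.1 - v p.2) ∂Q = (Q.prod volume) S := by
    rw [Measure.prod_apply hSm]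
    refine lintegral_congr fun p => ?_
    rw [← Real.volume_Ico]; rfl
  have hmeas : Measurable fun t : ℝ => π {x | t < v x} :=
    Antitone.measurable fun a b hab => measure_mono fun x hx => lt_of_le_of_lt hab hx
  rw [h1, Measure.prod_apply_symm hSm,
    lintegral_eq_lintegral_meas_lt π (Eventually.of_forall hv0) hv.aemeasurable,
    ← lintegral_const_mul _ hmeas]
  refine le_trans (setLIntegral_mono' measurableSet_Ioi fun t ht => ?_)
    (setLIntegral_le_lintegral (Set.Ioi 0) _)
  refine (hκ t ht).trans (measure_mono ?_)
  rintro ⟨x, y⟩ ⟨hx, hy⟩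
  exact ⟨not_lt.1 hy, hx⟩

/-- Cheeger's inequality for a nonnegative function supported on a set of measure at most one
half. -/
theorem cheeger_of_nonneg {κ : ℝ} (hκ0 : 0 < κ) (h1 : MeasurePreserving Prod.fst Q π)
    (h2 : MeasurePreserving Prod.snd Q π)
    (hκ : ∀ A, MeasurableSet A → π A ≤ 1 / 2 → ENNReal.ofReal κ * π A ≤ Q (A ×ˢ Aᶜ))
    {u : X → ℝ} (hu : Measurable u) (hu0 : ∀ x, 0 ≤ u x) (hu2 : MemLp u 2 π)
    (hhalf : π {x | 0 < u x} ≤ 1 / 2) :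
    κ ^ 2 / 4 * ∫ x, u x ^ 2 ∂π ≤ ∫ p, (u p.1 - u p.2) ^ 2 ∂Q := by
  have hL1 : MemLp (fun p : X × X => u p.1) 2 Q := hu2.comp_measurePreserving h1
  have hL2 : MemLp (fun p : X × X => u p.2) 2 Q := hu2.comp_measurePreserving h2
  have hi1 := hL1.integrable_sq
  have hi2 := hL2.integrable_sq
  have hiE : Integrable (fun p : X × X => (u p.1 - u p.2) ^ 2) Q := (hL1.sub hL2).integrable_sq
  have hI1 : ∫ p, u p.1 ^ 2 ∂Q = ∫ x, u x ^ 2 ∂π := by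
    rw [← h1.map_eq, integral_map h1.aemeasurable (hu.pow_const 2).aestronglyMeasurable]
  have hI2 : ∫ p, u p.2 ^ 2 ∂Q = ∫ x, u x ^ 2 ∂π := by
    rw [← h2.map_eq, integral_map h2.aemeasurable (hu.pow_const 2).aestronglyMeasurable]
  have hco := mul_lintegral_le_lintegral_sub (π := π) (Q := Q) (κ := ENNReal.ofReal κ)
    (v := fun x => u x ^ 2) (hu.pow_const 2) (fun x => sq_nonneg _) fun t ht => by
      refine hκ _ (measurableSet_lt measurable_const (hu.pow_const 2))
        ((measure_mono fun x hx => ?_).trans hhalf)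
      refine lt_of_le_of_ne (hu0 x) fun h0 => ?_
      have : t < u x ^ 2 := hx
      rw [← h0] at this
      norm_num at this
      linarith
  -- Young's inequality on `(a - b)(a + b)`. With weight `κ / 4` the two marginals contribute `κ / 2
  -- * ∫ u²`, half of the left-hand side, which is then absorbed.
  have hpt : ∀ p : X × X, u p.1 ^ 2 - u p.2 ^ 2
      ≤ κ / 4 * (u p.1 ^ 2 + u p.2 ^ 2) + 2 / κ * (u p.1 - u p.2) ^ 2 := fun p => by
    have e : κ / 4 * (u p.1 ^ 2 + u p.2 ^ 2) + 2 / κ * (u p.1 - u p.2) ^ 2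
        - (u p.1 ^ 2 - u p.2 ^ 2)
        = 2 / κ * ((u p.1 - u p.2) - κ / 4 * (u p.1 + u p.2)) ^ 2
          + κ / 8 * (u p.1 - u p.2) ^ 2 := by
      field_simp; ring
    have : 0 ≤ 2 / κ * ((u p.1 - u p.2) - κ / 4 * (u p.1 + u p.2)) ^ 2
          + κ / 8 * (u p.1 - u p.2) ^ 2 := by positivity
    linarith
  have hR : Integrable (fun p : X × X =>
      κ / 4 * (u p.1 ^ 2 + u p.2 ^ 2) + 2 / κ * (u p.1 - u p.2) ^ 2) Q :=
    ((hi1.add hi2).const_mul _).add (hiE.const_mul _)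
  have hR0 : ∀ p : X × X, 0 ≤ κ / 4 * (u p.1 ^ 2 + u p.2 ^ 2) + 2 / κ * (u p.1 - u p.2) ^ 2 :=
    fun p => by positivity
  have hfin : ENNReal.ofReal (κ * ∫ x, u x ^ 2 ∂π) ≤ ENNReal.ofReal (∫ p : X × X,
      (κ / 4 * (u p.1 ^ 2 + u p.2 ^ 2) + 2 / κ * (u p.1 - u p.2) ^ 2) ∂Q) := by
    rw [ENNReal.ofReal_mul hκ0.le, ofReal_integral_eq_lintegral_ofReal hu2.integrable_sq
      (Eventually.of_forall fun x => sq_nonneg _), ofReal_integral_eq_lintegral_ofReal hR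
      (Eventually.of_forall hR0)]
    exact hco.trans (lintegral_mono fun p => ENNReal.ofReal_le_ofReal (hpt p))
  have hfin' := (ENNReal.ofReal_le_ofReal_iff (integral_nonneg hR0)).1 hfin
  have hi12 : Integrable (fun p : X × X => κ / 4 * (u p.1 ^ 2 + u p.2 ^ 2)) Q :=
    (hi1.add hi2).const_mul _
  rw [integral_add hi12 (hiE.const_mul _), integral_const_mul,
    integral_const_mul, integral_add hi1 hi2, hI1, hI2] at hfin'
  set I := ∫ x, u x ^ 2 ∂π
  set E := ∫ p : X × X, (u p.1 - u p.2) ^ 2 ∂Q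
  have h3 : κ / 2 * I ≤ 2 / κ * E := by linarith
  have h4 := mul_le_mul_of_nonneg_left h3 (by positivity : 0 ≤ κ / 2)
  have h5 : κ / 2 * (2 / κ * E) = E := by field_simp
  linarith

variable [IsProbabilityMeasure π]

/-- Cheeger's inequality for a coupling `Q` of `π` with itself; no reversibility is needed. -/
theorem cheeger {κ : ℝ} (hκ0 : 0 < κ) (h1 : MeasurePreserving Prod.fst Q π)
    (h2 : MeasurePreserving Prod.snd Q π)
    (hκ : ∀ A, MeasurableSet A → π A ≤ 1 / 2 → ENNReal.ofReal κ * π A ≤ Q (A ×ˢ Aᶜ))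
    {f : X → ℝ} (hf : Measurable f) (hf2 : MemLp f 2 π) (hf0 : ∫ x, f x ∂π = 0) :
    κ ^ 2 / 4 * ∫ x, f x ^ 2 ∂π ≤ ∫ p, (f p.1 - f p.2) ^ 2 ∂Q := by
  obtain ⟨m, hm1, hm2⟩ := exists_median π hf
  set a : X → ℝ := fun x => max (f x - m) 0 with ha
  set b : X → ℝ := fun x => max (m - f x) 0 with hb
  have hfm : MemLp (fun x => f x - m) 2 π := hf2.sub (memLp_const m)
  have hmf : MemLp (fun x => m - f x) 2 π := (memLp_const m).sub hf2
  have ham : Measurable a := by fun_prop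
  have hbm : Measurable b := by fun_prop
  have ha2 : MemLp a 2 π := hfm.mono ham.aestronglyMeasurable (Eventually.of_forall fun x => by
    simp only [ha, Real.norm_eq_abs, abs_of_nonneg (le_max_right (f x - m) 0)]
    exact max_le (le_abs_self _) (abs_nonneg _))
  have hb2 : MemLp b 2 π := hmf.mono hbm.aestronglyMeasurable (Eventually.of_forall fun x => by
    simp only [hb, Real.norm_eq_abs, abs_of_nonneg (le_max_right (m - f x) 0)]
    exact max_le (le_abs_self _) (abs_nonneg _))
  have hca := cheeger_of_nonneg hκ0 h1 h2 hκ ham (fun x => le_max_right _ _) ha2 (by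
    simpa [ha] using hm1)
  have hcb := cheeger_of_nonneg hκ0 h1 h2 hκ hbm (fun x => le_max_right _ _) hb2 (by
    simpa [hb] using hm2)
  -- Since `f` has mean zero, centring at the median only adds `m²`, which helps.
  have hsum : ∫ x, a x ^ 2 ∂π + ∫ x, b x ^ 2 ∂π = ∫ x, f x ^ 2 ∂π + m ^ 2 := by
    rw [← integral_add ha2.integrable_sq hb2.integrable_sq]
    have : ∀ x, a x ^ 2 + b x ^ 2 = f x ^ 2 + (m ^ 2 - 2 * m * f x) := fun x => by
      rcases le_total (f x) m with h | h
      · simp only [ha, hb, max_eq_right (sub_nonpos.2 h), max_eq_left (sub_nonneg.2 h)]; ring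
      · simp only [ha, hb, max_eq_right (sub_nonpos.2 h), max_eq_left (sub_nonneg.2 h)]; ring
    simp_rw [this]
    have hfi : Integrable (fun x => 2 * m * f x) π := (hf2.integrable one_le_two).const_mul _
    have hgi : Integrable (fun x => m ^ 2 - 2 * m * f x) π := (integrable_const _).sub hfi
    rw [integral_add hf2.integrable_sq hgi,
      integral_sub (integrable_const _) hfi, integral_const_mul, hf0]
    simp
  have hLd : ∀ {g : X → ℝ}, MemLp g 2 π →
      Integrable (fun p : X × X => (g p.1 - g p.2) ^ 2) Q := fun {g} hg =>
    ((hg.comp_measurePreserving h1).sub (hg.comp_measurePreserving h2)).integrable_sq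
  have hE : ∫ p, (a p.1 - a p.2) ^ 2 ∂Q + ∫ p, (b p.1 - b p.2) ^ 2 ∂Q
      ≤ ∫ p, (f p.1 - f p.2) ^ 2 ∂Q := by
    rw [← integral_add (hLd ha2) (hLd hb2)]
    refine integral_mono ((hLd ha2).add (hLd hb2)) (hLd hf2) fun p => ?_
    simp only [ha, hb]
    rcases le_total (f p.1) m with h | h <;> rcases le_total (f p.2) m with h' | h' <;>
      simp only [max_eq_right (sub_nonpos.2 h), max_eq_left (sub_nonneg.2 h),
        max_eq_right (sub_nonpos.2 h'), max_eq_left (sub_nonneg.2 h')] <;>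
      nlinarith [mul_nonneg (sub_nonneg.2 h) (sub_nonneg.2 h')]
  have : 0 ≤ κ ^ 2 / 4 * m ^ 2 := by positivity
  have h6 := congrArg (fun z => κ ^ 2 / 4 * z) hsum
  simp only [mul_add] at h6
  linarith

end Cheeger

/-! ### Equivalence of variance bounding and positive conductance -/

namespace PAR

open scoped InnerProductSpace

variable {X : Type*} [MeasurableSpace X] {π : Measure X} [IsProbabilityMeasure π]

section Chain

variable {P : Kernel X X} [IsMarkovKernel P]

theorem chainLaw_eval_zero_one {A B : Set X} (hA : MeasurableSet A) (hB : MeasurableSet B) :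
    chainLaw π P {ω | ω 0 ∈ A ∧ ω 1 ∈ B} = ∫⁻ x in A, P x B ∂π := by
  have hA' : MeasurableSet ((fun z : (i : Finset.Iic 0) → X =>
      z ⟨0, Finset.mem_Iic.mpr le_rfl⟩) ⁻¹' A) := measurable_pi_apply _ hA
  have h := DFunLike.congr_fun (map_history_compProd (π := π) (P := P) 0)
    (((fun z : (i : Finset.Iic 0) → X => z ⟨0, Finset.mem_Iic.mpr le_rfl⟩) ⁻¹' A) ×ˢ B)
  rw [Measure.compProd_apply_prod hA' hB, Measure.map_apply (by fun_prop) (hA'.prod hB)] at h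
  refine Eq.trans ?_ (h.symm.trans ?_)
  · rfl
  · have hP : Measurable fun x => P x B := P.measurable_coe hB
    rw [setLIntegral_map hA' (by simp only [Kernel.comap_apply]; fun_prop) (by fun_prop)]
    conv_rhs => rw [← map_chainLaw_zero (π := π) (P := P)]
    rw [setLIntegral_map hA hP (by fun_prop)]
    rfl

/-- The law of `(X_0, X_1)` gives `A ×ˢ Aᶜ` the stationary flow out of `A`. -/
theorem map_eval_zero_one_prod_compl {A : Set X} (hA : MeasurableSet A) :
    (chainLaw π P).map (fun ω => (ω 0, ω 1)) (A ×ˢ Aᶜ) = ∫⁻ x in A, P x Aᶜ ∂π := by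
  rw [Measure.map_apply (by fun_prop) (hA.prod hA.compl), ← chainLaw_eval_zero_one hA hA.compl]
  rfl

theorem norm_evalIsometry_one_sub_zero (hπ : Kernel.Invariant P π) (f : Lp ℝ 2 π) :
    ‖evalIsometry hπ 1 f - evalIsometry hπ 0 f‖ ^ 2
      = ∫ p, (f p.1 - f p.2) ^ 2 ∂((chainLaw π P).map fun ω => (ω 0, ω 1)) := by
  have hm : Measurable f := (Lp.stronglyMeasurable f).measurable
  rw [integral_map (by fun_prop) (by fun_prop), ← real_inner_self_eq_norm_sq, L2.inner_def]
  refine integral_congr_ae ?_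
  filter_upwards [Lp.coeFn_sub (evalIsometry hπ 1 f) (evalIsometry hπ 0 f),
    coeFn_evalIsometry hπ 0 f, coeFn_evalIsometry hπ 1 f] with ω e1 e2 e3
  rw [e1, Pi.sub_apply, e2, e3]
  simp; ring

/-- Positive conductance gives a spectral gap for the additive symmetrisation of `P`. -/
theorem spectral_gap_of_conductance_pos (hπ : Kernel.Invariant P π) (hκ : 0 < conductance π P) :
    ∃ c : ℝ, 0 < c ∧ ∀ f : Lp ℝ 2 π, ⟪oneLp π, f⟫_ℝ = 0 →
      c * ‖f‖ ^ 2 ≤ ⟪f - markovOperator hπ f, f⟫_ℝ := by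
  -- The conductance may be `∞`, so a finite positive `r` below it is used.
  obtain ⟨r, hr0, hr⟩ := ENNReal.lt_iff_exists_nnreal_btwn.1 hκ
  have hr0' : (0 : ℝ) < r := by exact_mod_cast hr0
  have hcond : ∀ A, MeasurableSet A → π A ≤ 1 / 2 →
      ENNReal.ofReal r * π A ≤ (chainLaw π P).map (fun ω => (ω 0, ω 1)) (A ×ˢ Aᶜ) := by
    intro A hA hA2
    rw [map_eval_zero_one_prod_compl hA, ENNReal.ofReal_coe_nnreal]
    rcases eq_or_ne (π A) 0 with h0 | h0
    · simp [h0]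
    · have h1 : (r : ℝ≥0∞) ≤ (π A)⁻¹ * ∫⁻ x in A, P x Aᶜ ∂π :=
        hr.le.trans (iInf₂_le_of_le A hA (iInf₂_le (pos_iff_ne_zero.2 h0) hA2))
      calc (r : ℝ≥0∞) * π A ≤ (π A)⁻¹ * (∫⁻ x in A, P x Aᶜ ∂π) * π A := by gcongr
        _ = ∫⁻ x in A, P x Aᶜ ∂π := by
          rw [mul_right_comm, ENNReal.inv_mul_cancel h0 (measure_ne_top _ _), one_mul]
  have : IsProbabilityMeasure ((chainLaw π P).map fun ω => (ω 0, ω 1)) :=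
    Measure.isProbabilityMeasure_map (by fun_prop)
  have h1 : MeasurePreserving Prod.fst ((chainLaw π P).map fun ω => (ω 0, ω 1)) π := by
    refine ⟨measurable_fst, ?_⟩
    rw [Measure.map_map (by fun_prop) (by fun_prop)]
    exact (measurePreserving_eval_chainLaw hπ 0).map_eq
  have h2 : MeasurePreserving Prod.snd ((chainLaw π P).map fun ω => (ω 0, ω 1)) π := by
    refine ⟨measurable_snd, ?_⟩
    rw [Measure.map_map (by fun_prop) (by fun_prop)]
    exact (measurePreserving_eval_chainLaw hπ 1).map_eq
  -- Cheeger's `r² / 4`, halved because the squared increment is twice the Dirichlet form.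
  refine ⟨(r : ℝ) ^ 2 / 8, by positivity, fun f hf => ?_⟩
  have h3 := cheeger hr0' h1 h2 hcond (Lp.stronglyMeasurable f).measurable (Lp.memLp f)
    (by rw [← inner_oneLp, hf])
  rw [← norm_evalIsometry_one_sub_zero hπ, norm_evalIsometry_succ_sub hπ 0] at h3
  have h4 : ‖f‖ ^ 2 = ∫ x, f x ^ 2 ∂π := by
    rw [← real_inner_self_eq_norm_sq, L2.inner_def]
    refine integral_congr_ae (Eventually.of_forall fun x => ?_)
    simp [pow_two]
  rw [h4]; linarith

theorem inner_oneLp_sub_proj (f : Lp ℝ 2 π) :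
    ⟪oneLp π, f - ⟪oneLp π, f⟫_ℝ • oneLp π⟫_ℝ = 0 := by
  rw [inner_sub_right, inner_smul_right, real_inner_self_eq_norm_sq, norm_oneLp]; simp

theorem varianceBounding_of_conductance_pos (hπ : Kernel.Invariant P π)
    (hκ : 0 < conductance π P) : VarianceBounding π P := by
  intro h hh
  obtain ⟨c, hc, hgap⟩ := spectral_gap_of_conductance_pos hπ hκ
  obtain ⟨g, hg⟩ := exists_poisson_solution (markovOperator hπ) norm_oneLp
    (markovOperator_oneLp hπ) (inner_oneLp_markovOperator hπ) hc hgap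
    (inner_oneLp_sub_proj (hh.toLp h))
  refine ⟨‖g‖ ^ 2 - ‖markovOperator hπ g‖ ^ 2, ?_⟩
  unfold HasAsymptoticVariance
  simp_rw [mul_variance_chainLaw hπ hh, ← hg]
  exact tendsto_norm_sq_sum_of_poisson _ _ (inner_evalIsometry_succ hπ) g

/-- Variance bounding makes the normalised partial sums uniformly bounded operators. -/
theorem exists_norm_sum_le_of_varianceBounding (hπ : Kernel.Invariant P π)
    (hVB : VarianceBounding π P) :
    ∃ C : ℝ, ∀ (n : ℕ) (f : Lp ℝ 2 π), ⟪oneLp π, f⟫_ℝ = 0 →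
      ‖∑ i ∈ Finset.range n, evalIsometry hπ i f‖ ≤ C * √n * ‖f‖ := by
  -- Centring makes `T n` act on the whole Banach space, as uniform boundedness requires; it does
  -- nothing to mean-zero functions.
  let center : Lp ℝ 2 π →L[ℝ] Lp ℝ 2 π :=
    ContinuousLinearMap.id ℝ _ - (innerSL ℝ (oneLp π)).smulRight (oneLp π)
  let T : ℕ → Lp ℝ 2 π →L[ℝ] Lp ℝ 2 (chainLaw π P) := fun n =>
    (√(n : ℝ))⁻¹ • ((∑ i ∈ Finset.range n, (evalIsometry hπ i).toContinuousLinearMap).comp center)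
  have hT : ∀ n f, T n f = (√(n : ℝ))⁻¹ • ∑ i ∈ Finset.range n,
      evalIsometry hπ i (f - ⟪oneLp π, f⟫_ℝ • oneLp π) := fun n f => by
    simp [T, center, Finset.smul_sum]
  have hpt : ∀ f, ∃ C, ∀ n, ‖T n f‖ ≤ C := fun f => by
    obtain ⟨v, hv⟩ := hVB f (Lp.memLp f)
    unfold HasAsymptoticVariance at hv
    simp_rw [mul_variance_chainLaw hπ (Lp.memLp f), Lp.toLp_coeFn] at hv
    obtain ⟨b, hb⟩ := hv.bddAbove_range
    refine ⟨√b, fun n => Real.le_sqrt_of_sq_le ?_⟩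
    have := hb ⟨n, rfl⟩
    rw [hT, norm_smul, mul_pow, norm_inv, inv_pow, Real.norm_of_nonneg (Real.sqrt_nonneg _),
      Real.sq_sqrt (Nat.cast_nonneg n)]
    exact this
  obtain ⟨C, hC⟩ := banach_steinhaus hpt
  refine ⟨C, fun n f hf => ?_⟩
  rcases Nat.eq_zero_or_pos n with rfl | hn
  · simp
  have hn' : 0 < √(n : ℝ) := Real.sqrt_pos.2 (by exact_mod_cast hn)
  have h1 := (T n).le_of_opNorm_le (hC n) f
  rw [hT, hf, zero_smul, sub_zero, norm_smul, norm_inv, Real.norm_of_nonneg hn'.le,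
    inv_mul_le_iff₀ hn'] at h1
  linarith

/-- By stationarity the square expands to `2 π(A)` minus twice the probability of staying in `A`. -/
theorem norm_sq_evalIsometry_sub_indicator (hπ : Kernel.Invariant P π) {A : Set X}
    (hA : MeasurableSet A) :
    ‖evalIsometry hπ 1 (indicatorConstLp 2 hA (measure_ne_top π A) (1 : ℝ))
        - evalIsometry hπ 0 (indicatorConstLp 2 hA (measure_ne_top π A) (1 : ℝ))‖ ^ 2
      = 2 * (∫⁻ x in A, P x Aᶜ ∂π).toReal := by
  set f := indicatorConstLp 2 hA (measure_ne_top π A) (1 : ℝ) with hf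
  have hff : ⟪f, f⟫_ℝ = π.real A := by
    rw [hf, L2.real_inner_indicatorConstLp_one_indicatorConstLp_one, Set.inter_self]
  have hm0 := measurePreserving_eval_chainLaw (P := P) hπ 0
  have hm1 := measurePreserving_eval_chainLaw (P := P) hπ 1
  have h01 : ⟪evalIsometry hπ 0 f, evalIsometry hπ 1 f⟫_ℝ
      = (chainLaw π P).real {ω | ω 0 ∈ A ∧ ω 1 ∈ A} :=
    L2.real_inner_indicatorConstLp_one_indicatorConstLp_one (hA.preimage hm0.measurable)
      (hA.preimage hm1.measurable)
  have hsplit : (chainLaw π P).real {ω | ω 0 ∈ A ∧ ω 1 ∈ A}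
      + (chainLaw π P).real {ω | ω 0 ∈ A ∧ ω 1 ∈ Aᶜ} = π.real A := by
    have h := measureReal_inter_add_sdiff (μ := chainLaw π P) (s := (fun ω : ℕ → X => ω 0) ⁻¹' A)
      (hA.preimage hm1.measurable)
    rw [measureReal_def, measureReal_def,
      measureReal_def (chainLaw π P) ((fun ω : ℕ → X => ω 0) ⁻¹' A), hm0.measure_preimage hA.nullMeasurableSet] at h
    exact h
  rw [norm_sub_sq_real, real_inner_comm, h01, LinearIsometry.norm_map, LinearIsometry.norm_map,
    ← real_inner_self_eq_norm_sq, hff, ← chainLaw_eval_zero_one hA hA.compl]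
  rw [← measureReal_def]
  linarith

theorem conductance_pos_of_varianceBounding (hπ : Kernel.Invariant P π)
    (hVB : VarianceBounding π P) : 0 < conductance π P := by
  obtain ⟨C, hC⟩ := exists_norm_sum_le_of_varianceBounding hπ hVB
  have hstep : ∀ i f, ‖evalIsometry hπ (i + 1) f - evalIsometry hπ i f‖
      = ‖evalIsometry hπ 1 f - evalIsometry hπ 0 f‖ := fun i f => by
    rw [← sq_eq_sq₀ (norm_nonneg _) (norm_nonneg _), norm_evalIsometry_succ_sub,
      norm_evalIsometry_succ_sub hπ 0]
  obtain ⟨M, hM0, hM⟩ := exists_norm_le_norm_sub_of_norm_sum_le (evalIsometry hπ) (oneLp π) hstep hC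
  -- The centred indicator has squared norm `π(A) - π(A)² ≥ π(A) / 2` and squared increment twice
  -- the flow, whence `π(A) / 2 ≤ 2 M²` times the flow.
  have hpos : (0 : ℝ≥0∞) < ENNReal.ofReal (1 / (4 * M ^ 2)) :=
    ENNReal.ofReal_pos.2 (by positivity)
  refine hpos.trans_le (le_iInf₂ fun A hA => le_iInf₂ fun hA0 hA2 => ?_)
  set f := indicatorConstLp 2 hA (measure_ne_top π A) (1 : ℝ) with hf
  have h1f : ⟪oneLp π, f⟫_ℝ = π.real A := by
    rw [real_inner_comm, hf, L2.inner_indicatorConstLp_one]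
    have : ∫ x in A, oneLp π x ∂π = ∫ x in A, (1 : ℝ) ∂π :=
      integral_congr_ae (ae_restrict_of_ae (memLp_const (μ := π) (p := 2) (1 : ℝ)).coeFn_toLp)
    rw [this]; simp
  have hff : ‖f‖ ^ 2 = π.real A := by
    rw [← real_inner_self_eq_norm_sq, hf, L2.real_inner_indicatorConstLp_one_indicatorConstLp_one,
      Set.inter_self]
  have h := hM _ (inner_oneLp_sub_proj f)
  have hcancel : evalIsometry hπ 1 (f - ⟪oneLp π, f⟫_ℝ • oneLp π)
      - evalIsometry hπ 0 (f - ⟪oneLp π, f⟫_ℝ • oneLp π)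
      = evalIsometry hπ 1 f - evalIsometry hπ 0 f := by
    simp only [map_sub, map_smul, evalIsometry_oneLp]; abel
  rw [hcancel] at h
  have h2 := pow_le_pow_left₀ (norm_nonneg _) h 2
  have hA2' : π.real A ≤ 1 / 2 := by
    have := ENNReal.toReal_mono (by simp) hA2
    simpa [measureReal_def] using this
  rw [mul_pow, norm_sq_evalIsometry_sub_indicator hπ hA, norm_sub_sq_real, norm_smul,
    inner_smul_right, real_inner_comm (oneLp π) f, h1f, norm_oneLp, hff, mul_one, Real.norm_eq_abs,
    sq_abs] at h2
  have hI : ∫⁻ x in A, P x Aᶜ ∂π ≠ ∞ := by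
    rw [← chainLaw_eval_zero_one hA hA.compl]; exact measure_ne_top _ _
  set I := ∫⁻ x in A, P x Aᶜ ∂π
  have hreal : 1 / (4 * M ^ 2) * π.real A ≤ I.toReal := by
    have h0 : 0 ≤ π.real A := measureReal_nonneg
    have h3 : π.real A / 2 ≤ M ^ 2 * (2 * I.toReal) := by nlinarith
    rw [div_mul_eq_mul_div, one_mul, div_le_iff₀ (by positivity)]
    linarith
  have hfin : ENNReal.ofReal (1 / (4 * M ^ 2)) * π A ≤ I := by
    rw [← ENNReal.ofReal_toReal hI, ← ENNReal.ofReal_toReal (measure_ne_top π A),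
      ← ENNReal.ofReal_mul (by positivity)]
    exact ENNReal.ofReal_le_ofReal hreal
  rw [mul_comm (π A)⁻¹, ← div_eq_mul_inv]
  exact (ENNReal.le_div_iff_mul_le (Or.inl hA0.ne') (Or.inl (measure_ne_top _ _))).2 hfin

end Chain

/-! ### Comparison of escape probabilities and conductances -/

section Comparison

variable {μ : Measure X} {qA αA qB αB : X → X → ℝ≥0} {PA PB : Kernel X X}

/-- The rejection atom sits at `x ∈ A`, so only accepted proposals leave `A`. -/
theorem IsProposeAcceptReject.apply_compl (hA : IsProposeAcceptReject μ qA αA PA) {A : Set X}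
    (hAm : MeasurableSet A) {x : X} (hx : x ∈ A) :
    PA x Aᶜ = ∫⁻ y in Aᶜ, (qA x y : ℝ≥0∞) * αA x y ∂μ := by
  rw [hA.kernel_eq x, Measure.add_apply, withDensity_apply _ hAm.compl, Measure.smul_apply,
    Measure.dirac_apply' _ hAm.compl]
  simp [hx]

/-- Where `D` dominates, the escape probability of `PB` is at least `δ` times that of `PA`, up to
the proposal mass outside `D`. -/
theorem mul_apply_compl_le (hA : IsProposeAcceptReject μ qA αA PA)
    (hB : IsProposeAcceptReject μ qB αB PB) {A D : Set X} (hAm : MeasurableSet A)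
    (hD : MeasurableSet D) {x : X} (hx : x ∈ A) {ε δ : ℝ≥0}
    (hε : ∫⁻ y in Dᶜ, (qA x y : ℝ≥0∞) ∂μ ≤ ε)
    (hδ : ∀ y ∈ D, δ * (qA x y * αA x y) ≤ qB x y * αB x y) :
    (δ : ℝ≥0∞) * PA x Aᶜ ≤ PB x Aᶜ + δ * ε := by
  rw [hA.apply_compl hAm hx, hB.apply_compl hAm hx]
  have hsplit := lintegral_inter_add_sdiff (μ := μ) (fun y => (qA x y : ℝ≥0∞) * αA x y) Aᶜ hD
  rw [← hsplit, mul_add]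
  refine add_le_add ?_ ?_
  · rw [← lintegral_const_mul' _ _ ENNReal.coe_ne_top]
    refine (setLIntegral_mono' (hAm.compl.inter hD) fun y hy => ?_).trans
      (lintegral_mono_set Set.inter_subset_left)
    exact_mod_cast hδ y hy.2
  · gcongr
    refine le_trans ((lintegral_mono fun y => ?_).trans
      (lintegral_mono_set (fun y hy => hy.2))) hε
    exact mul_le_of_le_one_right' (ENNReal.coe_le_one_iff.2 (hA.accept_le_one x y))

theorem conductance_comparison [IsMarkovKernel PA] (hA : IsProposeAcceptReject μ qA αA PA)
    (hB : IsProposeAcceptReject μ qB αB PB) {ε δ : ℝ≥0} (hε : (ε : ℝ≥0∞) < conductance π PA)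
    (hdom : RegionDomination π μ qA αA qB αB ε δ) :
    (1 - (ε : ℝ≥0∞) / conductance π PA) * δ * conductance π PA ≤ conductance π PB := by
  refine le_iInf₂ fun A hAm => le_iInf₂ fun hA0 hA2 => ?_
  have hPA : Measurable fun x => PA x Aᶜ := PA.measurable_coe hAm.compl
  have hPB : Measurable fun x => PB x Aᶜ := PB.measurable_coe hAm.compl
  set κ := conductance π PA with hκ
  set IA := ∫⁻ x in A, PA x Aᶜ ∂π with hIA_def
  set IB := ∫⁻ x in A, PB x Aᶜ ∂π with hIB
  have hA0' : π A ≠ 0 := hA0.ne'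
  have hAt : π A ≠ ∞ := measure_ne_top _ _
  have hκA : κ ≤ (π A)⁻¹ * IA := iInf₂_le_of_le A hAm (iInf₂_le hA0 hA2)
  have hint : (δ : ℝ≥0∞) * IA ≤ IB + δ * ε * π A := by
    rw [hIA_def, hIB, ← lintegral_const_mul _ hPA, ← setLIntegral_const, ← lintegral_add_left hPB]
    refine lintegral_mono_ae ((ae_restrict_iff' hAm).2 ?_)
    filter_upwards [hdom] with x hx hxA
    obtain ⟨D, hD, h1, h2⟩ := hx
    exact mul_apply_compl_le hA hB hAm hD hxA h1 h2
  have hmain : (δ : ℝ≥0∞) * κ ≤ (π A)⁻¹ * IB + δ * ε := by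
    calc (δ : ℝ≥0∞) * κ ≤ δ * ((π A)⁻¹ * IA) := by gcongr
      _ = (π A)⁻¹ * (δ * IA) := by ring
      _ ≤ (π A)⁻¹ * (IB + δ * ε * π A) := by gcongr
      _ = (π A)⁻¹ * IB + δ * ε * ((π A)⁻¹ * π A) := by ring
      _ = (π A)⁻¹ * IB + δ * ε := by rw [ENNReal.inv_mul_cancel hA0' hAt, mul_one]
  -- One admissible `A` already forces `κ ≤ 1`. Hence `κ = ∞` occurs only when no set is admissible,
  -- and then the infimum for `PB` is also `∞`.
  have hIA : IA ≤ π A := by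
    refine (lintegral_mono fun x => ?_).trans_eq (setLIntegral_one A)
    exact prob_le_one
  have hκt : κ ≠ ∞ := ne_top_of_le_ne_top
    (ENNReal.mul_ne_top (ENNReal.inv_ne_top.2 hA0') (ne_top_of_le_ne_top hAt hIA)) hκA
  have hκ0 : κ ≠ 0 := (pos_of_gt hε).ne'
  have hid : (1 - (ε : ℝ≥0∞) / κ) * δ * κ = δ * κ - δ * ε := by
    rw [mul_right_comm, ENNReal.sub_mul fun _ _ => hκt, one_mul, ENNReal.div_mul_cancel hκ0 hκt,
      mul_comm, ENNReal.mul_sub fun _ _ => ENNReal.coe_ne_top]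
  rw [hid]
  exact tsub_le_iff_right.2 hmain

end Comparison

end PAR

theorem theorem1 {X : Type*} [MeasurableSpace X] (μ π : Measure X) [IsProbabilityMeasure π]
    (qA αA qB αB : X → X → ℝ≥0) (PA PB : Kernel X X) [IsMarkovKernel PA] [IsMarkovKernel PB]
    (hA : PAR.IsProposeAcceptReject μ qA αA PA) (hB : PAR.IsProposeAcceptReject μ qB αB PB)
    (hπA : Kernel.Invariant PA π) (hπB : Kernel.Invariant PB π)
    (hVB : PAR.VarianceBounding π PA)
    (hdom : ∀ ε : ℝ≥0, 0 < ε → ∃ δ : ℝ≥0, 0 < δ ∧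
      PAR.RegionDomination π μ qA αA qB αB ε δ) :
    PAR.VarianceBounding π PB ∧
    0 < PAR.conductance π PA ∧
    ∀ ε δ : ℝ≥0, (ε : ℝ≥0∞) < PAR.conductance π PA → 0 < δ →
      PAR.RegionDomination π μ qA αA qB αB ε δ →
      (1 - (ε : ℝ≥0∞) / PAR.conductance π PA) * δ * PAR.conductance π PA
        ≤ PAR.conductance π PB := by
  have hκA := PAR.conductance_pos_of_varianceBounding hπA hVB
  refine ⟨?_, hκA, fun ε δ hε _ h => PAR.conductance_comparison hA hB hε h⟩
  refine PAR.varianceBounding_of_conductance_pos hπB ?_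
  -- Any `ε` strictly between `0` and the conductance of `PA` makes the comparison bound positive.
  obtain ⟨ε, hε0, hε⟩ := ENNReal.lt_iff_exists_nnreal_btwn.1 hκA
  obtain ⟨δ, hδ, h⟩ := hdom ε (by exact_mod_cast hε0)
  refine lt_of_lt_of_le ?_ (PAR.conductance_comparison hA hB hε h)
  have hlt : (ε : ℝ≥0∞) / PAR.conductance π PA < 1 := by
    rw [ENNReal.div_lt_iff (Or.inl hκA.ne') (Or.inr ENNReal.coe_ne_top), one_mul]
    exact hε
  have hδ' : (δ : ℝ≥0∞) ≠ 0 := by exact_mod_cast hδ.ne'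
  exact pos_iff_ne_zero.2
    (mul_ne_zero (mul_ne_zero (tsub_pos_of_lt hlt).ne' hδ') hκA.ne')
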